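/- Let $l\ge 1$ be an integer, let $T_l=\{0,2,4,\dots,2l,\,2l+1,2l+3,\dots,4l+1\}$, and let $$K_l=\left\{\sum_{i=1}^{\infty}\frac{\varepsilon_i}{(2l+2)^i} : \varepsilon_i\in T_l \text{ for all } i\ge 1\right\}\subset\mathbb R .$$ Then $K_l$ is the set of subsums $\{\sum_{n\ge1}\delta_n z_n : \delta_n\in\{0,1\}\}$ of the convergent multigeometric series $$\sum_{n=1}^{\infty} z_n=\frac{2l+1}{2l+2}+\underbrace{\frac{2}{2l+2}+\dots+\frac{2}{2l+2}}_{l}+\dots+\frac{2l+1}{(2l+2)^i}+\underbrace{\frac{2}{(2l+2)^i}+\dots+\frac{2}{(2l+2)^i}}_{l}+\dots,$$ and $K_l$ is a Cantorval (M-Cantorval): it is homeomorphic to $$C\cup\bigcup_{n=1}^{\infty}G_{2n-1}=[0,1]\setminus\bigcup_{n=1}^{\infty}G_{2n},$$ where $C$ is the Cantor ternary set and $G_n$ is the union of the $2^{n-1}$ open middle thirds removed from $[0,1]$ at the $n$-th step of the construction of $C$. In particular, $K_l$ is a perfect set with non-empty interior. -/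

import Mathlib

namespace Cantorval

/-- The digit set `T_l = {0, 2, …, 2l} ∪ {2l+1, 2l+3, …, 4l+1}`. -/
def digits (l : ℕ) : Set ℕ :=
  {d | ∃ j : ℕ, j ≤ l ∧ (d = 2 * j ∨ d = 2 * l + 1 + 2 * j)}

/-- The set `K_l` of all sums `∑_{i ≥ 1} ε_i / (2l+2)^i` with digits `ε_i ∈ T_l`
(the sequence is indexed from `0` here). -/
def K (l : ℕ) : Set ℝ :=
  {x | ∃ ε : ℕ → ℕ, (∀ i, ε i ∈ digits l) ∧
    HasSum (fun i => (ε i : ℝ) / (2 * (l : ℝ) + 2) ^ (i + 1)) x}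

/-- The terms of the multigeometric series, indexed from `0`: the `i`-th block (`i ≥ 1`) has
`l + 1` terms, namely `(2l+1)/(2l+2)^i` followed by `l` copies of `2/(2l+2)^i`. -/
noncomputable def z (l n : ℕ) : ℝ :=
  (if n % (l + 1) = 0 then 2 * (l : ℝ) + 1 else 2) / (2 * (l : ℝ) + 2) ^ (n / (l + 1) + 1)

/-- The set of subsums (achievement set) `{∑ ε_n u_n : ε_n ∈ {0, 1}}` of the series `∑ u_n`. -/
def subsums (u : ℕ → ℝ) : Set ℝ :=
  {x | ∃ ε : ℕ → ℕ, (∀ n, ε n = 0 ∨ ε n = 1) ∧ HasSum (fun n => (ε n : ℝ) * u n) x}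

/-- `G_n` for `n ≥ 1`: the union of the open middle thirds removed at the `n`-th step of the
construction of the Cantor ternary set (`preCantorSet n` is what is left after `n` steps). -/
def G (n : ℕ) : Set ℝ := preCantorSet (n - 1) \ preCantorSet n

/-- The model M-Cantorval `C ∪ ⋃_{n ≥ 1} G_{2n-1}`. -/
def model : Set ℝ := cantorSet ∪ ⋃ n : ℕ, G (2 * n + 1)

/-- A set of reals is an M-Cantorval if it is homeomorphic to the model. -/
def IsMCantorval (X : Set ℝ) : Prop := Nonempty (X ≃ₜ model)

/-- The model is also `[0, 1] ∖ ⋃_{n ≥ 1} G_{2n}`. -/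
theorem model_eq : model = Set.Icc 0 1 \ ⋃ n : ℕ, G (2 * n + 2) := by
  have hanti : Antitone preCantorSet := preCantorSet_antitone
  have h0 : preCantorSet 0 = Set.Icc (0 : ℝ) 1 := rfl
  ext x
  simp only [model, cantorSet, G, Set.mem_union, Set.mem_iInter, Set.mem_iUnion, Set.mem_sdiff,
    not_exists, not_and, not_not, ← h0]
  constructor
  · rintro (h | ⟨n, h1, h2⟩)
    · exact ⟨h 0, fun n _ => h _⟩
    · refine ⟨hanti (Nat.zero_le _) h1, fun m hm => ?_⟩
      by_contra hm'
      rcases le_or_gt n m with h | h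
      · exact h2 (hanti (by omega) hm)
      · exact hm' (hanti (by omega) h1)
  · rintro ⟨hx, h⟩
    by_contra hc
    push Not at hc
    obtain ⟨hc1, hc2⟩ := hc
    obtain ⟨k, hk⟩ := hc1
    have : ∀ n, x ∈ preCantorSet n := by
      intro n
      induction n with
      | zero => exact hx
      | succ n ih =>
        rcases Nat.even_or_odd' n with ⟨m, rfl | rfl⟩
        · exact hc2 m (by simpa using ih)
        · exact h m (by simpa using ih)
    exact hk (this k)

end Cantorval

/-! The topological type is pinned down by an intrinsic property, `IsGood`: nonempty, compact,
regular closed, with no point where a complementary interval abuts an interval of the set. Any two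
good sets are homeomorphic (`IsGood.nonempty_homeomorph`), so it suffices that the model and `K l`
are both good.

For a good `X`, colour each bounded gap of `frontier X` by whether it lies in `X`. The gaps form a
countable order without endpoints in which both colours are dense (`IsGood.colorDense`).
Back-and-forth matches the gaps of two good sets, colours included; affine maps on gaps and
completion give an order isomorphism of the convex hulls, which carries one set onto the other.

For `K l`, the digits are a complete residue system modulo `2l+2`, so integer translates of `K l`
cover the line and Baire's theorem gives interior; self-similarity makes the interior dense in `K
l`. A point with a hole on its left must be a corner `N / (2l+2)^k`. Holes accumulate at such a
corner from the right, because `max K l < 2` and `0` is the only digit below `2` when `l ≥ 1`. The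
symmetry of the digits handles the other side. -/

namespace Cantorval

/-! ### Back-and-forth for coloured linear orders -/

section ColoredOrders

variable {α β γ : Type*} [LinearOrder α] [LinearOrder β]

/-- A colouring of a linear order such that every cut between two finite sets contains points of
every colour. -/
def ColorDense (c : α → γ) : Prop :=
  ∀ (k : γ) (lo hi : Finset α), (∀ x ∈ lo, ∀ y ∈ hi, x < y) →
    ∃ m, c m = k ∧ (∀ x ∈ lo, x < m) ∧ ∀ y ∈ hi, m < y

theorem colorDense_of_exists {c : α → γ} (hne : ∀ k, ∃ m, c m = k)
    (hgt : ∀ k x, ∃ m, c m = k ∧ x < m) (hlt : ∀ k x, ∃ m, c m = k ∧ m < x)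
    (hbtw : ∀ k x y, x < y → ∃ m, c m = k ∧ x < m ∧ m < y) : ColorDense c := by
  intro k lo hi h
  rcases lo.eq_empty_or_nonempty with rfl | nlo <;> rcases hi.eq_empty_or_nonempty with rfl | nhi
  · simpa using hne k
  · obtain ⟨m, hm, hlt⟩ := hlt k (hi.min' nhi)
    exact ⟨m, hm, by simp, fun y hy => hlt.trans_le (hi.min'_le y hy)⟩
  · obtain ⟨m, hm, hgt⟩ := hgt k (lo.max' nlo)
    exact ⟨m, hm, fun x hx => (lo.le_max' x hx).trans_lt hgt, by simp⟩
  · obtain ⟨m, hm, h1, h2⟩ := hbtw k _ _ (h _ (lo.max'_mem nlo) _ (hi.min'_mem nhi))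
    exact ⟨m, hm, fun x hx => (lo.le_max' x hx).trans_lt h1,
      fun y hy => h2.trans_le (hi.min'_le y hy)⟩

/-- A finite set of pairs that is the graph of a colour preserving partial order isomorphism. -/
def IsColorPartialIso (c : α → γ) (d : β → γ) (f : Finset (α × β)) : Prop :=
  (∀ p ∈ f, d p.2 = c p.1) ∧ ∀ p ∈ f, ∀ q ∈ f, cmp p.1 q.1 = cmp p.2 q.2

theorem IsColorPartialIso.swap {c : α → γ} {d : β → γ} {f : Finset (α × β)}
    (hf : IsColorPartialIso c d f) :
    IsColorPartialIso d c (f.map (Equiv.prodComm α β).toEmbedding) := by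
  constructor
  · intro p hp
    obtain ⟨p, hpf, rfl⟩ := Finset.mem_map.1 hp
    exact (hf.1 p hpf).symm
  · intro p hp q hq
    obtain ⟨p, hpf, rfl⟩ := Finset.mem_map.1 hp
    obtain ⟨q, hqf, rfl⟩ := Finset.mem_map.1 hq
    exact (hf.2 p hpf q hqf).symm

theorem IsColorPartialIso.exists_insert {c : α → γ} {d : β → γ} (hd : ColorDense d)
    {f : Finset (α × β)} (hf : IsColorPartialIso c d f) (a : α) :
    ∃ b, IsColorPartialIso c d (insert (a, b) f) := by
  classical
  by_cases h : ∃ b, (a, b) ∈ f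
  · obtain ⟨b, hb⟩ := h
    exact ⟨b, by rwa [Finset.insert_eq_of_mem hb]⟩
  obtain ⟨b, hbc, hlo, hhi⟩ := hd (c a) ((f.filter (fun p => p.1 < a)).image Prod.snd)
    ((f.filter (fun p => a < p.1)).image Prod.snd) (by
      intro x hx y hy
      simp only [Finset.mem_image, Finset.mem_filter] at hx hy
      obtain ⟨p, ⟨hp, hpa⟩, rfl⟩ := hx
      obtain ⟨q, ⟨hq, hqa⟩, rfl⟩ := hy
      exact (lt_iff_lt_of_cmp_eq_cmp (hf.2 p hp q hq)).1 (hpa.trans hqa))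
  have key : ∀ p ∈ f, cmp p.1 a = cmp p.2 b := by
    intro p hp
    rcases lt_trichotomy p.1 a with hl | he | hr
    · have := hlo p.2 (Finset.mem_image_of_mem _ (Finset.mem_filter.2 ⟨hp, hl⟩))
      rw [(cmp_eq_lt_iff _ _).2 hl, (cmp_eq_lt_iff _ _).2 this]
    · exact (h ⟨p.2, he ▸ hp⟩).elim
    · have := hhi p.2 (Finset.mem_image_of_mem _ (Finset.mem_filter.2 ⟨hp, hr⟩))
      rw [(cmp_eq_gt_iff _ _).2 hr, (cmp_eq_gt_iff _ _).2 this]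
  refine ⟨b, fun p hp => ?_, fun p hp q hq => ?_⟩
  · rcases Finset.mem_insert.1 hp with rfl | hp
    · exact hbc
    · exact hf.1 p hp
  · rcases Finset.mem_insert.1 hp with rfl | hp <;> rcases Finset.mem_insert.1 hq with rfl | hq
    · simp
    · exact cmp_eq_cmp_symm.2 (key q hq)
    · exact key p hp
    · exact hf.2 p hp q hq

theorem IsColorPartialIso.exists_insert_right {c : α → γ} {d : β → γ} (hc : ColorDense c)
    {f : Finset (α × β)} (hf : IsColorPartialIso c d f) (b : β) :
    ∃ a, IsColorPartialIso c d (insert (a, b) f) := by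
  classical
  obtain ⟨a, ha⟩ := hf.swap.exists_insert hc b
  refine ⟨a, ?_⟩
  convert ha.swap using 1
  ext p
  simp [Prod.ext_iff]

/-- Cantor's back-and-forth theorem for coloured orders. -/
theorem exists_colored_orderIso [Countable α] [Countable β] {c : α → γ} {d : β → γ}
    (hc : ColorDense c) (hd : ColorDense d) : ∃ e : α ≃o β, ∀ a, d (e a) = c a := by
  classical
  cases nonempty_encodable α
  cases nonempty_encodable β
  let Q := {f : Finset (α × β) // IsColorPartialIso c d f}
  let q₀ : Q := ⟨∅, by simp [IsColorPartialIso]⟩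
  let toCofinal : α ⊕ β → Order.Cofinal Q := fun s =>
    Sum.casesOn s
      (fun a =>
        { carrier := {f : Q | ∃ b, (a, b) ∈ f.1}
          isCofinal := fun f => by
            obtain ⟨b, hb⟩ := f.2.exists_insert hd a
            exact ⟨⟨_, hb⟩, ⟨b, Finset.mem_insert_self _ _⟩, Finset.subset_insert _ _⟩ })
      (fun b =>
        { carrier := {f : Q | ∃ a, (a, b) ∈ f.1}
          isCofinal := fun f => by
            obtain ⟨a, ha⟩ := f.2.exists_insert_right hc b
            exact ⟨⟨_, ha⟩, ⟨a, Finset.mem_insert_self _ _⟩, Finset.subset_insert _ _⟩ })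
  -- A generic ideal: meeting every cofinal set makes the matching total on both sides, and
  -- directedness makes any two of its pairs compatible.
  let I := Order.idealOfCofinals q₀ toCofinal
  have hl : ∀ a, ∃ b, ∃ f ∈ I, (a, b) ∈ f.1 := fun a => by
    obtain ⟨f, ⟨b, hb⟩, hf⟩ := Order.cofinal_meets_idealOfCofinals q₀ toCofinal (Sum.inl a)
    exact ⟨b, f, hf, hb⟩
  have hr : ∀ b, ∃ a, ∃ f ∈ I, (a, b) ∈ f.1 := fun b => by
    obtain ⟨f, ⟨a, ha⟩, hf⟩ := Order.cofinal_meets_idealOfCofinals q₀ toCofinal (Sum.inr b)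
    exact ⟨a, f, hf, ha⟩
  choose F hF using hl
  choose H hH using hr
  refine ⟨OrderIso.ofCmpEqCmp F H fun a b => ?_, fun a => ?_⟩
  · obtain ⟨f, hf, ha⟩ := hF a
    obtain ⟨g, hg, hb⟩ := hH b
    obtain ⟨m, -, fm, gm⟩ := I.directed _ hf _ hg
    exact m.2.2 (a, _) (fm ha) (_, b) (gm hb)
  · obtain ⟨f, hf, ha⟩ := hF a
    exact f.2.1 _ ha

end ColoredOrders

/-! ### Extending an order pattern to complete orders -/

section Extension

variable {ι α β : Type*} [CompleteLinearOrder α] [CompleteLinearOrder β]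

theorem lt_sSup_image_iff_of_dense {j : ι → α} {j' : ι → β} (h : ∀ p q, j p < j q ↔ j' p < j' q)
    (hj : ∀ x y, x < y → ∃ p, x < j p ∧ j p < y) (x : α) (q : ι) :
    j' q < sSup (j' '' {p | j p ≤ x}) ↔ j q < x := by
  simp only [lt_sSup_iff, Set.mem_image, Set.mem_ofPred_eq]
  constructor
  · rintro ⟨_, ⟨p, hp, rfl⟩, hq⟩
    exact ((h q p).2 hq).trans_le hp
  · intro hq
    obtain ⟨p, h1, h2⟩ := hj _ _ hq
    exact ⟨_, ⟨p, h2.le, rfl⟩, (h q p).1 h1⟩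

theorem eq_of_forall_lt_iff_of_dense {j : ι → α} (hj : ∀ x y, x < y → ∃ p, x < j p ∧ j p < y)
    {x y : α} (hxy : ∀ q, j q < x ↔ j q < y) : x = y := by
  rcases lt_trichotomy x y with hl | he | hl
  · obtain ⟨p, h1, h2⟩ := hj _ _ hl
    exact absurd ((hxy p).2 h2) h1.not_gt
  · exact he
  · obtain ⟨p, h1, h2⟩ := hj _ _ hl
    exact absurd ((hxy p).1 h2) h1.not_gt

/-- Two families with order-dense ranges in complete linear orders and with the same order pattern
are exchanged by an order isomorphism. -/
theorem exists_orderIso_of_dense (j : ι → α) (j' : ι → β) (h : ∀ p q, j p < j q ↔ j' p < j' q)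
    (hj : ∀ x y, x < y → ∃ p, x < j p ∧ j p < y)
    (hj' : ∀ x y, x < y → ∃ p, x < j' p ∧ j' p < y) :
    ∃ F : α ≃o β, ∀ p, F (j p) = j' p := by
  let F : α → β := fun x => sSup (j' '' {p | j p ≤ x})
  let H : β → α := fun y => sSup (j '' {p | j' p ≤ y})
  have hF : ∀ x q, j' q < F x ↔ j q < x := lt_sSup_image_iff_of_dense h hj
  have hH : ∀ y q, j q < H y ↔ j' q < y :=
    lt_sSup_image_iff_of_dense (fun p q => (h p q).symm) hj'
  have hFm : Monotone F := fun x y hxy =>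
    sSup_le_sSup (Set.image_mono fun p (hp : j p ≤ x) => hp.trans hxy)
  have hHm : Monotone H := fun x y hxy =>
    sSup_le_sSup (Set.image_mono fun p (hp : j' p ≤ x) => hp.trans hxy)
  have hHF : ∀ x, H (F x) = x := fun x =>
    eq_of_forall_lt_iff_of_dense hj fun q => by rw [hH, hF]
  have hFH : ∀ y, F (H y) = y := fun y =>
    eq_of_forall_lt_iff_of_dense hj' fun q => by rw [hF, hH]
  refine ⟨⟨⟨F, H, hHF, hFH⟩, fun {x y} => ⟨fun hxy => ?_, fun hxy => hFm hxy⟩⟩, fun p => ?_⟩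
  · have := hHm hxy
    simpa only [Equiv.coe_fn_mk, hHF] using this
  · exact eq_of_forall_lt_iff_of_dense hj' fun q => (hF _ q).trans (h q p)

end Extension

open Set

/-! ### Gaps of closed sets -/

/-- `(a, b)` is a bounded connected component of the complement of `P`. -/
structure IsGap (P : Set ℝ) (a b : ℝ) : Prop where
  left_mem : a ∈ P
  right_mem : b ∈ P
  lt : a < b
  notMem : ∀ x, a < x → x < b → x ∉ P

theorem IsGap.right_le {P : Set ℝ} {a b x : ℝ} (h : IsGap P a b) (hx : x ∈ P) (hax : a < x) :
    b ≤ x :=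
  not_lt.1 fun hxb => h.notMem x hax hxb hx

theorem IsGap.right_unique {P : Set ℝ} {a b b' : ℝ} (h : IsGap P a b) (h' : IsGap P a b') :
    b = b' :=
  le_antisymm (h.right_le h'.right_mem h'.lt) (h'.right_le h.right_mem h.lt)

theorem exists_isGap {P : Set ℝ} (hP : IsClosed P) {p q x : ℝ} (hp : p ∈ P) (hq : q ∈ P)
    (hpx : p < x) (hxq : x < q) (hx : x ∉ P) :
    ∃ a b, IsGap P a b ∧ p ≤ a ∧ a < x ∧ x < b ∧ b ≤ q := by
  have hne : (P ∩ Iic x).Nonempty := ⟨p, hp, hpx.le⟩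
  have hne' : (P ∩ Ici x).Nonempty := ⟨q, hq, hxq.le⟩
  have hbd : BddAbove (P ∩ Iic x) := ⟨x, fun y hy => hy.2⟩
  have hbd' : BddBelow (P ∩ Ici x) := ⟨x, fun y hy => hy.2⟩
  have ha := (hP.inter isClosed_Iic).csSup_mem hne hbd
  have hb := (hP.inter isClosed_Ici).csInf_mem hne' hbd'
  have hax : sSup (P ∩ Iic x) < x := lt_of_le_of_ne ha.2 fun h => hx (h ▸ ha.1)
  have hxb : x < sInf (P ∩ Ici x) := lt_of_le_of_ne hb.2 fun h => hx (h ▸ hb.1)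
  refine ⟨_, _, ⟨ha.1, hb.1, hax.trans hxb, fun y h1 h2 hy => ?_⟩, le_csSup hbd ⟨hp, hpx.le⟩,
    hax, hxb, csInf_le hbd' ⟨hq, hxq.le⟩⟩
  rcases le_total y x with h | h
  · exact h1.not_ge (le_csSup hbd ⟨hy, h⟩)
  · exact h2.not_ge (csInf_le hbd' ⟨hy, h⟩)

/-- Off the frontier, the line splits into the disjoint open sets `interior X` and `Xᶜ`. This gives
each gap of the frontier a well-defined colour. -/
theorem subset_or_disjoint_of_disjoint_frontier {X s : Set ℝ} (hX : IsClosed X)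
    (hs : IsPreconnected s) (h : Disjoint s (frontier X)) : s ⊆ X ∨ Disjoint s X := by
  rcases hs.subset_or_subset isOpen_interior hX.isOpen_compl
    (disjoint_compl_right.mono_left interior_subset) (fun x hx => by
      by_cases hxX : x ∈ X
      · left
        by_contra hi
        exact disjoint_left.1 h hx (hX.frontier_eq ▸ ⟨hxX, hi⟩)
      · exact Or.inr hxX) with h | h
  · exact Or.inl (h.trans interior_subset)
  · exact Or.inr (disjoint_left.2 h)

/-! ### Good sets and the gaps of their frontier -/

/-- A nonempty compact regular closed set of reals such that no complementary interval is adjacent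
to an interval contained in the set. -/
structure IsGood (X : Set ℝ) : Prop where
  isCompact : IsCompact X
  nonempty : X.Nonempty
  subset_closure : X ⊆ closure (interior X)
  not_left : ∀ a b c, a < b → b < c → b ∈ X → Disjoint (Ioo a b) X → ¬ Ioo b c ⊆ X
  not_right : ∀ a b c, a < b → b < c → b ∈ X → Ioo a b ⊆ X → ¬ Disjoint (Ioo b c) X

namespace IsGood

variable {X : Set ℝ}

theorem exists_mem_interior (hX : IsGood X) {a b x : ℝ} (hx : x ∈ X) (hax : a < x) (hxb : x < b) :
    ∃ y ∈ interior X, a < y ∧ y < b := by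
  obtain ⟨y, hy, hyi⟩ := mem_closure_iff.1 (hX.subset_closure hx) _ isOpen_Ioo ⟨hax, hxb⟩
  exact ⟨y, hyi, hy⟩

theorem frontier_subset (hX : IsGood X) : frontier X ⊆ X :=
  hX.isCompact.isClosed.frontier_subset

/-- The interval left of `b` is inside `X` or misses `X`. In the first case `not_right` supplies
points of `X` on the right, and points outside `X` occur there because `b` is not interior. In the
second, regularity forces interior points onto the right and `not_left` supplies the others. -/
theorem exists_of_left_isolated (hX : IsGood X) {a b c : ℝ} (hab : a < b) (hbc : b < c)
    (hb : b ∈ frontier X) (hd : Disjoint (Ioo a b) (frontier X)) :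
    (∃ x ∈ interior X, b < x ∧ x < c) ∧ ∃ x ∉ X, b < x ∧ x < c := by
  have hbX := hX.frontier_subset hb
  rcases subset_or_disjoint_of_disjoint_frontier hX.isCompact.isClosed isPreconnected_Ioo hd
    with h | h
  · refine ⟨?_, ?_⟩
    · obtain ⟨x, hx, hxX⟩ := not_disjoint_iff.1 (hX.not_right a b c hab hbc hbX h)
      obtain ⟨y, hy, h1, h2⟩ := hX.exists_mem_interior hxX hx.1 hx.2
      exact ⟨y, hy, h1, h2⟩
    · by_contra! hc
      refine (hX.isCompact.isClosed.frontier_eq ▸ hb : b ∈ X \ interior X).2 ?_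
      refine mem_interior.2 ⟨Ioo a c, fun x hx => ?_, isOpen_Ioo, hab, hbc⟩
      rcases lt_trichotomy x b with hl | rfl | hl
      · exact h ⟨hx.1, hl⟩
      · exact hbX
      · by_contra hxX
        exact (hc x hxX hl).not_gt hx.2
  · refine ⟨?_, ?_⟩
    · obtain ⟨y, hy, h1, h2⟩ := hX.exists_mem_interior hbX hab hbc
      obtain ⟨z, hz, hz1, hz2⟩ : ∃ z ∈ interior X, a < z ∧ z < c ∧ z ≠ b :=
        ⟨y, hy, h1, h2, fun h => by
          subst h
          exact (hX.isCompact.isClosed.frontier_eq ▸ hb : y ∈ X \ interior X).2 hy⟩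
      rcases lt_or_gt_of_ne hz2.2 with hl | hl
      · exact (disjoint_left.1 h ⟨hz1, hl⟩ (interior_subset hz)).elim
      · exact ⟨z, hz, hl, hz2.1⟩
    · obtain ⟨x, hx, hxX⟩ := not_subset.1 (hX.not_left a b c hab hbc hbX h)
      exact ⟨x, hxX, hx⟩

theorem sInf_mem (hX : IsGood X) : sInf X ∈ X := hX.isCompact.sInf_mem hX.nonempty

theorem sSup_mem (hX : IsGood X) : sSup X ∈ X := hX.isCompact.sSup_mem hX.nonempty

theorem sInf_le (hX : IsGood X) {x : ℝ} (hx : x ∈ X) : sInf X ≤ x :=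
  csInf_le hX.isCompact.bddBelow hx

theorem le_sSup (hX : IsGood X) {x : ℝ} (hx : x ∈ X) : x ≤ sSup X :=
  le_csSup hX.isCompact.bddAbove hx

theorem sInf_mem_frontier (hX : IsGood X) : sInf X ∈ frontier X := by
  rw [hX.isCompact.isClosed.frontier_eq]
  refine ⟨hX.sInf_mem, fun h => ?_⟩
  obtain ⟨e, he, hs⟩ := Metric.isOpen_iff.1 isOpen_interior _ h
  have := hX.sInf_le (interior_subset (hs (show sInf X - e / 2 ∈ _ by
    rw [Metric.mem_ball, Real.dist_eq, abs_lt]; constructor <;> linarith)))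
  linarith

theorem sSup_mem_frontier (hX : IsGood X) : sSup X ∈ frontier X := by
  rw [hX.isCompact.isClosed.frontier_eq]
  refine ⟨hX.sSup_mem, fun h => ?_⟩
  obtain ⟨e, he, hs⟩ := Metric.isOpen_iff.1 isOpen_interior _ h
  have := hX.le_sSup (interior_subset (hs (show sSup X + e / 2 ∈ _ by
    rw [Metric.mem_ball, Real.dist_eq, abs_lt]; constructor <;> linarith)))
  linarith

/-- Makes `sInf X` count as a left isolated frontier point, on the same footing as right endpoints
of gaps. -/
theorem disjoint_Ioo_sInf (hX : IsGood X) : Disjoint (Ioo (sInf X - 1) (sInf X)) (frontier X) :=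
  disjoint_left.2 fun _ hx hxX => hx.2.not_ge (hX.sInf_le (hX.frontier_subset hxX))

theorem right_lt_sSup (hX : IsGood X) {a b : ℝ} (h : IsGap (frontier X) a b) : b < sSup X := by
  refine lt_of_le_of_ne (hX.le_sSup (hX.frontier_subset h.right_mem)) fun he => ?_
  obtain ⟨⟨x, hx, h1, -⟩, -⟩ := hX.exists_of_left_isolated h.lt (lt_add_one b) h.right_mem
    (disjoint_left.2 fun x hx => h.notMem x hx.1 hx.2)
  exact h1.not_ge (he ▸ hX.le_sSup (interior_subset hx))

/-- To the right of a left isolated frontier point there are gaps of both kinds. -/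
theorem exists_isGap_of_left_isolated (hX : IsGood X) {a b c : ℝ} (hab : a < b) (hbc : b < c)
    (hb : b ∈ frontier X) (hc : c ∈ frontier X) (hd : Disjoint (Ioo a b) (frontier X)) (k : Prop) :
    ∃ a' b', IsGap (frontier X) a' b' ∧ ((Ioo a' b' ⊆ X) = k) ∧ b ≤ a' ∧ b' ≤ c := by
  obtain ⟨⟨x, hx, h1, h2⟩, ⟨y, hy, h3, h4⟩⟩ := hX.exists_of_left_isolated hab hbc hb hd
  by_cases hk : k
  · obtain ⟨a', b', hg, h5, h6, h7, h8⟩ := exists_isGap isClosed_frontier hb hc h1 h2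
      (disjoint_left.1 disjoint_interior_frontier hx)
    refine ⟨a', b', hg, ?_, h5, h8⟩
    rcases subset_or_disjoint_of_disjoint_frontier hX.isCompact.isClosed isPreconnected_Ioo
      (disjoint_left.2 fun x hx => hg.notMem x hx.1 hx.2 : Disjoint (Ioo a' b') _) with h | h
    · simp [h, hk]
    · exact (disjoint_left.1 h ⟨h6, h7⟩ (interior_subset hx)).elim
  · obtain ⟨a', b', hg, h5, h6, h7, h8⟩ := exists_isGap isClosed_frontier hb hc h3 h4
      (fun h => hy (hX.frontier_subset h))
    refine ⟨a', b', hg, ?_, h5, h8⟩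
    simp only [hk, eq_iff_iff, iff_false]
    exact fun h => hy (h ⟨h6, h7⟩)

theorem sInf_lt_left (hX : IsGood X) {a b : ℝ} (h : IsGap (frontier X) a b) : sInf X < a := by
  refine lt_of_le_of_ne (hX.sInf_le (hX.frontier_subset h.left_mem)) fun he => ?_
  have hd := hX.disjoint_Ioo_sInf
  rw [he] at hd
  obtain ⟨⟨x, hx, h1, h2⟩, ⟨y, hy, h3, h4⟩⟩ :=
    hX.exists_of_left_isolated (sub_one_lt a) h.lt h.left_mem hd
  rcases subset_or_disjoint_of_disjoint_frontier hX.isCompact.isClosed isPreconnected_Ioo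
      (disjoint_left.2 fun x hx => h.notMem x hx.1 hx.2 : Disjoint (Ioo a b) _) with h | h
  · exact hy (h ⟨h3, h4⟩)
  · exact disjoint_left.1 h ⟨h1, h2⟩ (interior_subset hx)

/-- The shared endpoint would be left isolated, so the second gap would contain points of both
colours. -/
theorem right_ne_left (hX : IsGood X) {a b c : ℝ} (h : IsGap (frontier X) a b)
    (h' : IsGap (frontier X) b c) : False := by
  obtain ⟨⟨x, hx, h1, h2⟩, ⟨y, hy, h3, h4⟩⟩ := hX.exists_of_left_isolated h.lt h'.lt h.right_mem
    (disjoint_left.2 fun x hx => h.notMem x hx.1 hx.2)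
  rcases subset_or_disjoint_of_disjoint_frontier hX.isCompact.isClosed isPreconnected_Ioo
      (disjoint_left.2 fun x hx => h'.notMem x hx.1 hx.2 : Disjoint (Ioo b c) _) with h | h
  · exact hy (h ⟨h3, h4⟩)
  · exact disjoint_left.1 h ⟨h1, h2⟩ (interior_subset hx)

end IsGood

/-- The left endpoints of the bounded gaps of a set of reals. -/
abbrev GapIndex (P : Set ℝ) : Type := {a : ℝ // ∃ b, IsGap P a b}

namespace GapIndex

variable {P : Set ℝ}

/-- The right endpoint of a gap. -/
noncomputable def right (a : GapIndex P) : ℝ := a.2.choose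

theorem isGap (a : GapIndex P) : IsGap P a.1 a.right := a.2.choose_spec

/-- The affine parametrization of the gap starting at `a` by the unit interval. -/
noncomputable def param (p : GapIndex P × Ioo (0 : ℝ) 1) : ℝ :=
  p.1.1 + (p.1.right - p.1.1) * p.2.1

theorem lt_param (p : GapIndex P × Ioo (0 : ℝ) 1) : p.1.1 < param p :=
  lt_add_of_pos_right _ (mul_pos (sub_pos.2 p.1.isGap.lt) p.2.2.1)

theorem param_lt (p : GapIndex P × Ioo (0 : ℝ) 1) : param p < p.1.right := by
  have := mul_pos (sub_pos.2 p.1.isGap.lt) (sub_pos.2 p.2.2.2)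
  unfold param
  linarith

theorem exists_param_eq {a b x : ℝ} (h : IsGap P a b) (hax : a < x) (hxb : x < b) :
    ∃ s, param (⟨⟨a, b, h⟩, s⟩ : GapIndex P × Ioo (0 : ℝ) 1) = x := by
  have hr : right (⟨a, b, h⟩ : GapIndex P) = b := (isGap (⟨a, b, h⟩ : GapIndex P)).right_unique h
  have hpos : 0 < b - a := sub_pos.2 h.lt
  refine ⟨⟨(x - a) / (b - a), div_pos (sub_pos.2 hax) hpos,
    (div_lt_one hpos).2 (by linarith)⟩, ?_⟩
  simp only [param, hr]
  field_simp
  ring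

/-- The order is lexicographic, so it depends only on the order of the gaps; an isomorphism of gap
orders therefore preserves the whole pattern. -/
theorem param_lt_param_iff (p q : GapIndex P × Ioo (0 : ℝ) 1) :
    param p < param q ↔ p.1 < q.1 ∨ p.1 = q.1 ∧ p.2 < q.2 := by
  have key : ∀ p q : GapIndex P × Ioo (0 : ℝ) 1, p.1 < q.1 → param p < param q := fun p q h =>
    (param_lt p).trans_le ((p.1.isGap.right_le q.1.isGap.left_mem h).trans (lt_param q).le)
  rcases lt_trichotomy p.1 q.1 with h | h | h
  · simp [h, key p q h]
  · obtain ⟨a, s⟩ := p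
    obtain ⟨a', t⟩ := q
    obtain rfl : a = a' := h
    have hpos := sub_pos.2 a.isGap.lt
    simp [param, hpos]
  · simp [h.not_gt, h.ne', (key q p h).not_gt]

instance : Countable (GapIndex P) := by
  have : {a | ∃ b, IsGap P a b}.Countable := by
    have hr : ∀ a ∈ {a | ∃ b, IsGap P a b}, ∃ b, IsGap P a b := fun a h => h
    choose! r hr using hr
    refine Set.PairwiseDisjoint.countable_of_Ioo (y := r) ?_ fun a ha => (hr a ha).lt
    intro a ha b hb hab
    refine disjoint_left.2 fun x hx hx' => ?_
    rcases lt_or_gt_of_ne hab with h | h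
    · exact (hx.2.trans_le ((hr a ha).right_le (hr b hb).left_mem h)).not_gt hx'.1
    · exact (hx'.2.trans_le ((hr b hb).right_le (hr a ha).left_mem h)).not_gt hx.1
  exact this.to_subtype

end GapIndex

/-! ### Any two good sets are homeomorphic -/

namespace IsGood

variable {X Y : Set ℝ}

open GapIndex

/-- The lower end of a cut is either `sInf X` or the right end of a gap. Both are left isolated, so
gaps of both colours follow at once. -/
theorem colorDense (hX : IsGood X) :
    ColorDense fun a : GapIndex (frontier X) => Ioo a.1 a.right ⊆ X := by
  have key : ∀ (k : Prop) {a b c : ℝ}, a < b → b < c → b ∈ frontier X → c ∈ frontier X →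
      Disjoint (Ioo a b) (frontier X) → ∃ m : GapIndex (frontier X),
        (Ioo m.1 m.right ⊆ X) = k ∧ b ≤ m.1 ∧ m.right ≤ c := by
    intro k a b c hab hbc hb hc hd
    obtain ⟨a', b', hg, hk, h1, h2⟩ := hX.exists_isGap_of_left_isolated hab hbc hb hc hd k
    have hr := (isGap (⟨a', b', hg⟩ : GapIndex (frontier X))).right_unique hg
    exact ⟨⟨a', b', hg⟩, by rw [hr]; exact hk, h1, hr.trans_le h2⟩
  have hdisj : ∀ x : GapIndex (frontier X), Disjoint (Ioo x.1 x.right) (frontier X) := fun x =>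
    disjoint_left.2 fun y hy => x.isGap.notMem y hy.1 hy.2
  refine colorDense_of_exists (fun k => ?_) (fun k x => ?_) (fun k x => ?_) fun k x y hxy => ?_
  · have hlt : sInf X < sSup X := by
      obtain ⟨⟨x, hx, h1, -⟩, -⟩ := hX.exists_of_left_isolated (sub_one_lt _) (lt_add_one _)
        hX.sInf_mem_frontier hX.disjoint_Ioo_sInf
      exact h1.trans_le (hX.le_sSup (interior_subset hx))
    obtain ⟨m, hm, -⟩ := key k (sub_one_lt _) hlt hX.sInf_mem_frontier hX.sSup_mem_frontier
      hX.disjoint_Ioo_sInf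
    exact ⟨m, hm⟩
  · obtain ⟨m, hm, h1, -⟩ := key k x.isGap.lt (hX.right_lt_sSup x.isGap) x.isGap.right_mem
      hX.sSup_mem_frontier (hdisj x)
    exact ⟨m, hm, x.isGap.lt.trans_le h1⟩
  · obtain ⟨m, hm, -, h1⟩ := key k (sub_one_lt _) (hX.sInf_lt_left x.isGap) hX.sInf_mem_frontier
      x.isGap.left_mem hX.disjoint_Ioo_sInf
    exact ⟨m, hm, m.isGap.lt.trans_le h1⟩
  · have hlt : x.right < y.1 := by
      refine lt_of_le_of_ne (x.isGap.right_le y.isGap.left_mem hxy) fun he => ?_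
      exact hX.right_ne_left x.isGap (he ▸ y.isGap)
    obtain ⟨m, hm, h1, h2⟩ := key k x.isGap.lt hlt x.isGap.right_mem y.isGap.left_mem (hdisj x)
    exact ⟨m, hm, x.isGap.lt.trans_le h1, m.isGap.lt.trans_le h2⟩

theorem param_mem_Icc (hX : IsGood X) (p : GapIndex (frontier X) × Ioo (0 : ℝ) 1) :
    param p ∈ Icc (sInf X) (sSup X) :=
  ⟨((hX.sInf_lt_left p.1.isGap).trans (lt_param p)).le,
    ((param_lt p).trans (hX.right_lt_sSup p.1.isGap)).le⟩

/-- The frontier of a closed set has empty interior, so every interval in the hull meets some gap.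
-/
theorem exists_param_between (hX : IsGood X) {x y : ℝ} (hx : sInf X ≤ x) (hxy : x < y)
    (hy : y ≤ sSup X) : ∃ p : GapIndex (frontier X) × Ioo (0 : ℝ) 1, x < param p ∧ param p < y := by
  obtain ⟨v, hv, hvP⟩ : ∃ v ∈ Ioo x y, v ∉ frontier X := by
    by_contra! h
    have h1 : Ioo x y ⊆ interior (frontier X) := interior_maximal h isOpen_Ioo
    rw [interior_frontier hX.isCompact.isClosed] at h1
    obtain ⟨z, hz⟩ := exists_between hxy
    exact h1 hz
  obtain ⟨a, b, hg, -, h1, h2, -⟩ := exists_isGap isClosed_frontier hX.sInf_mem_frontier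
    hX.sSup_mem_frontier (hx.trans_lt hv.1) (hv.2.trans_le hy) hvP
  obtain ⟨s, hs⟩ := exists_param_eq hg h1 h2
  exact ⟨_, by rw [hs]; exact hv.1, by rw [hs]; exact hv.2⟩

theorem notMem_iff (hX : IsGood X) {x : ℝ} (hx : x ∈ Icc (sInf X) (sSup X)) :
    x ∉ X ↔ ∃ p : GapIndex (frontier X) × Ioo (0 : ℝ) 1,
      param p = x ∧ ¬ Ioo p.1.1 p.1.right ⊆ X := by
  constructor
  · intro h
    obtain ⟨a, b, hg, -, h1, h2, -⟩ := exists_isGap isClosed_frontier hX.sInf_mem_frontier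
      hX.sSup_mem_frontier (lt_of_le_of_ne hx.1 fun he => h (he ▸ hX.sInf_mem))
      (lt_of_le_of_ne hx.2 fun he => h (he ▸ hX.sSup_mem)) fun hf => h (hX.frontier_subset hf)
    obtain ⟨s, hs⟩ := exists_param_eq hg h1 h2
    refine ⟨_, hs, fun hsub => h (hs ▸ hsub ⟨lt_param _, param_lt _⟩)⟩
  · rintro ⟨p, rfl, hp⟩ h
    rcases subset_or_disjoint_of_disjoint_frontier hX.isCompact.isClosed isPreconnected_Ioo
      (disjoint_left.2 fun x hx => p.1.isGap.notMem x hx.1 hx.2 : Disjoint (Ioo p.1.1 p.1.right) _)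
      with h' | h'
    · exact hp h'
    · exact disjoint_left.1 h' ⟨lt_param p, param_lt p⟩ h

theorem nonempty_homeomorph (hX : IsGood X) (hY : IsGood Y) : Nonempty (X ≃ₜ Y) := by
  obtain ⟨e, he⟩ := exists_colored_orderIso hX.colorDense hY.colorDense
  have : Fact (sInf X ≤ sSup X) := ⟨hX.sInf_le hX.sSup_mem⟩
  have : Fact (sInf Y ≤ sSup Y) := ⟨hY.sInf_le hY.sSup_mem⟩
  obtain ⟨F, hF⟩ := exists_orderIso_of_dense
    (α := Icc (sInf X) (sSup X)) (β := Icc (sInf Y) (sSup Y))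
    (fun p : GapIndex (frontier X) × Ioo (0 : ℝ) 1 => ⟨param p, hX.param_mem_Icc p⟩)
    (fun p => ⟨param (e p.1, p.2), hY.param_mem_Icc _⟩)
    (fun p q => by
      simp only [Subtype.mk_lt_mk, param_lt_param_iff, e.lt_iff_lt, e.apply_eq_iff_eq])
    (fun x y hxy => hX.exists_param_between x.2.1 hxy y.2.2)
    (fun x y hxy => by
      obtain ⟨p, hp⟩ := hY.exists_param_between x.2.1 hxy y.2.2
      refine ⟨(e.symm p.1, p.2), ?_⟩
      simpa [← Subtype.coe_lt_coe] using hp)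
  -- Points of the hull outside the set are exactly those in gaps of the negative colour, and `e`
  -- preserves colours.
  have hmem : ∀ x, (F x).1 ∈ Y ↔ x.1 ∈ X := fun x => by
    rw [← not_iff_not, hX.notMem_iff x.2, hY.notMem_iff (F x).2]
    constructor
    · rintro ⟨p, hp, hpc⟩
      refine ⟨(e.symm p.1, p.2), ?_, ?_⟩
      · have := hF (e.symm p.1, p.2)
        simp only [e.apply_symm_apply, Prod.mk.eta] at this
        have h2 : F ⟨param (e.symm p.1, p.2), hX.param_mem_Icc _⟩ = F x :=
          this.trans (Subtype.ext hp)
        exact congrArg Subtype.val (F.injective h2)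
      · have := he (e.symm p.1)
        simp only [e.apply_symm_apply] at this
        rwa [this] at hpc
    · rintro ⟨p, hp, hpc⟩
      refine ⟨(e p.1, p.2), ?_, ?_⟩
      · have h1 : (⟨param p, hX.param_mem_Icc p⟩ : Icc (sInf X) (sSup X)) = x := Subtype.ext hp
        have := hF p
        rw [h1] at this
        rw [this]
      · have := he p.1
        simp only at this ⊢
        rwa [this]
  have hcX : ∀ x : X, x.1 ∈ Icc (sInf X) (sSup X) := fun x => ⟨hX.sInf_le x.2, hX.le_sSup x.2⟩
  have hcY : ∀ y : Y, y.1 ∈ Icc (sInf Y) (sSup Y) := fun y => ⟨hY.sInf_le y.2, hY.le_sSup y.2⟩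
  let H : Icc (sInf X) (sSup X) ≃ₜ Icc (sInf Y) (sSup Y) := F.toHomeomorph
  refine ⟨⟨⟨fun x => ⟨(H ⟨x.1, hcX x⟩).1, (hmem _).2 x.2⟩,
    fun y => ⟨(H.symm ⟨y.1, hcY y⟩).1, (hmem _).1 ?_⟩, fun x => ?_, fun y => ?_⟩, ?_, ?_⟩⟩
  · exact (congrArg Subtype.val (H.apply_symm_apply ⟨y.1, hcY y⟩)).symm ▸ y.2
  · simp
  · simp
  · exact (continuous_subtype_val.comp (H.continuous.comp
      (continuous_subtype_val.subtype_mk hcX))).subtype_mk _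
  · exact (continuous_subtype_val.comp (H.symm.continuous.comp
      (continuous_subtype_val.subtype_mk hcY))).subtype_mk _

end IsGood

/-! ### The model is good -/

theorem mem_preCantorSet_succ_iff {n : ℕ} {x : ℝ} :
    x ∈ preCantorSet (n + 1) ↔ 3 * x ∈ preCantorSet n ∨ 3 * x - 2 ∈ preCantorSet n := by
  rw [preCantorSet_succ]
  constructor
  · rintro (⟨y, hy, rfl⟩ | ⟨y, hy, rfl⟩)
    · left; convert hy using 1; ring
    · right; convert hy using 1; ring
  · rintro (h | h)
    · exact Or.inl ⟨_, h, by ring⟩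
    · exact Or.inr ⟨_, h, by ring⟩

theorem mem_G_one_iff {x : ℝ} : x ∈ G 1 ↔ 1 / 3 < x ∧ x < 2 / 3 := by
  simp only [G, Nat.sub_self, mem_sdiff, mem_preCantorSet_succ_iff (n := 0), preCantorSet_zero,
    mem_Icc, not_or, not_and, not_le]
  constructor
  · rintro ⟨⟨h0, h1⟩, h2, h3⟩
    have := h2 (by linarith)
    refine ⟨by linarith, ?_⟩
    by_contra! h
    have := h3 (by linarith)
    linarith
  · rintro ⟨h1, h2⟩
    exact ⟨⟨by linarith, by linarith⟩, fun _ => by linarith, fun h => by linarith⟩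

theorem mem_G_add_two_iff {n : ℕ} {x : ℝ} :
    x ∈ G (n + 2) ↔ 3 * x ∈ G (n + 1) ∨ 3 * x - 2 ∈ G (n + 1) := by
  have hI : ∀ {k : ℕ} {y : ℝ}, y ∈ preCantorSet k → 0 ≤ y ∧ y ≤ 1 :=
    fun h => preCantorSet_subset_unitInterval h
  simp only [G, Nat.add_sub_cancel, show n + 2 - 1 = n + 1 by omega, mem_sdiff]
  rw [mem_preCantorSet_succ_iff (n := n), mem_preCantorSet_succ_iff (n := n + 1)]
  constructor
  · rintro ⟨h | h, h'⟩
    · exact Or.inl ⟨h, fun h2 => h' (Or.inl h2)⟩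
    · exact Or.inr ⟨h, fun h2 => h' (Or.inr h2)⟩
  · rintro (⟨h, h'⟩ | ⟨h, h'⟩)
    · refine ⟨Or.inl h, ?_⟩
      rintro (h2 | h2)
      · exact h' h2
      · linarith [(hI h).2, (hI h2).1]
    · refine ⟨Or.inr h, ?_⟩
      rintro (h2 | h2)
      · linarith [(hI h).1, (hI h2).2]
      · exact h' h2

theorem isOpen_G_succ (n : ℕ) : IsOpen (G (n + 1)) := by
  induction n with
  | zero =>
    have : G (0 + 1) = Ioo (1 / 3) (2 / 3) := by ext x; exact mem_G_one_iff
    rw [this]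
    exact isOpen_Ioo
  | succ n ih =>
    have : G (n + 1 + 1) = (fun x => 3 * x) ⁻¹' G (n + 1) ∪ (fun x => 3 * x - 2) ⁻¹' G (n + 1) := by
      ext x; exact mem_G_add_two_iff
    rw [this]
    exact (ih.preimage (by fun_prop)).union (ih.preimage (by fun_prop))

theorem exists_mem_G_abs_sub_le (n : ℕ) {x : ℝ} (hx : x ∈ preCantorSet n) :
    ∃ y ∈ G (n + 1), |y - x| ≤ (1 / 3) ^ n := by
  induction n generalizing x with
  | zero =>
    refine ⟨1 / 2, mem_G_one_iff.2 (by norm_num), ?_⟩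
    rw [preCantorSet_zero] at hx
    rw [abs_le]
    constructor <;> linarith [hx.1, hx.2]
  | succ n ih =>
    rcases mem_preCantorSet_succ_iff.1 hx with h | h
    · obtain ⟨y, hy, hd⟩ := ih h
      refine ⟨y / 3, mem_G_add_two_iff.2 (Or.inl (by convert hy using 1; ring)), ?_⟩
      rw [show y / 3 - x = (y - 3 * x) * (1 / 3) by ring, abs_mul, pow_succ,
        abs_of_pos (by norm_num : (0 : ℝ) < 1 / 3)]
      gcongr
    · obtain ⟨y, hy, hd⟩ := ih h
      refine ⟨(y + 2) / 3, mem_G_add_two_iff.2 (Or.inr (by convert hy using 1; ring)), ?_⟩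
      rw [show (y + 2) / 3 - x = (y - (3 * x - 2)) * (1 / 3) by ring, abs_mul, pow_succ,
        abs_of_pos (by norm_num : (0 : ℝ) < 1 / 3)]
      gcongr

theorem mem_cantorSet_iff {x : ℝ} : x ∈ cantorSet ↔ 3 * x ∈ cantorSet ∨ 3 * x - 2 ∈ cantorSet := by
  conv_lhs => rw [cantorSet_eq_union_halves]
  constructor
  · rintro (⟨y, hy, rfl⟩ | ⟨y, hy, rfl⟩)
    · left; convert hy using 1; ring
    · right; convert hy using 1; ring
  · rintro (h | h)
    · exact Or.inl ⟨_, h, by ring⟩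
    · exact Or.inr ⟨_, h, by ring⟩

theorem one_mem_cantorSet : (1 : ℝ) ∈ cantorSet := by
  refine mem_iInter.2 fun n => ?_
  induction n with
  | zero => simp
  | succ n ih => exact mem_preCantorSet_succ_iff.2 (Or.inr (by convert ih using 1; norm_num))

theorem exists_mem_cantorSet_ne (n : ℕ) {x : ℝ} (hx : x ∈ cantorSet) :
    ∃ y ∈ cantorSet, y ≠ x ∧ |y - x| ≤ (1 / 3) ^ n := by
  induction n generalizing x with
  | zero =>
    have hI := cantorSet_subset_unitInterval hx
    by_cases h : x = 0
    · refine ⟨1, one_mem_cantorSet, ?_, ?_⟩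
      · simp [h]
      · simp [h]
    · exact ⟨0, zero_mem_cantorSet, Ne.symm h, by
        rw [abs_le]; constructor <;> linarith [hI.1, hI.2]⟩
  | succ n ih =>
    rcases mem_cantorSet_iff.1 hx with h | h
    · obtain ⟨y, hy, hne, hd⟩ := ih h
      refine ⟨y / 3, mem_cantorSet_iff.2 (Or.inl (by convert hy using 1; ring)), ?_, ?_⟩
      · intro he; apply hne; linarith
      rw [show y / 3 - x = (y - 3 * x) * (1 / 3) by ring, abs_mul, pow_succ,
        abs_of_pos (by norm_num : (0 : ℝ) < 1 / 3)]
      gcongr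
    · obtain ⟨y, hy, hne, hd⟩ := ih h
      refine ⟨(y + 2) / 3, mem_cantorSet_iff.2 (Or.inr (by convert hy using 1; ring)), ?_, ?_⟩
      · intro he; apply hne; linarith
      rw [show (y + 2) / 3 - x = (y - (3 * x - 2)) * (1 / 3) by ring, abs_mul, pow_succ,
        abs_of_pos (by norm_num : (0 : ℝ) < 1 / 3)]
      gcongr

theorem exists_mem_cantorSet_Ioo {a b c : ℝ} (hab : a < b) (hbc : b < c) (hb : b ∈ cantorSet) :
    ∃ y ∈ cantorSet, (a < y ∧ y < b) ∨ (b < y ∧ y < c) := by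
  obtain ⟨n, hn⟩ := exists_pow_lt_of_lt_one (lt_min (sub_pos.2 hab) (sub_pos.2 hbc))
    (by norm_num : (1 / 3 : ℝ) < 1)
  obtain ⟨y, hy, hne, hd⟩ := exists_mem_cantorSet_ne n hb
  have h := abs_lt.1 (hd.trans_lt hn)
  have h1 := min_le_left (b - a) (c - b)
  have h2 := min_le_right (b - a) (c - b)
  refine ⟨y, hy, ?_⟩
  rcases lt_or_gt_of_ne hne with hl | hl
  · exact Or.inl ⟨by linarith, hl⟩
  · exact Or.inr ⟨hl, by linarith⟩

/-- The parameter `r` selects parity: `0` gives the odd levels kept in the model, `1` the even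
levels removed from it. -/
theorem exists_mem_G_Ioo {a b x : ℝ} (hax : a < x) (hxb : x < b) (hx : x ∈ cantorSet) (r : ℕ) :
    ∃ n, ∃ y ∈ G (2 * n + r + 1), a < y ∧ y < b := by
  obtain ⟨n, hn⟩ := exists_pow_lt_of_lt_one (lt_min (sub_pos.2 hax) (sub_pos.2 hxb))
    (by norm_num : (1 / 3 : ℝ) < 1)
  obtain ⟨y, hy, hd⟩ := exists_mem_G_abs_sub_le (2 * n + r) (mem_iInter.1 hx (2 * n + r))
  have h3 : (1 / 3 : ℝ) ^ (2 * n + r) ≤ (1 / 3) ^ n :=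
    pow_le_pow_of_le_one (by norm_num) (by norm_num) (by omega)
  have h := abs_lt.1 ((hd.trans h3).trans_lt hn)
  have h1 := min_le_left (x - a) (b - x)
  have h2 := min_le_right (x - a) (b - x)
  exact ⟨n, y, hy, by linarith, by linarith⟩

theorem G_odd_subset_interior_model (n : ℕ) : G (2 * n + 1) ⊆ interior model :=
  interior_maximal (fun _ hx => Or.inr (mem_iUnion.2 ⟨n, hx⟩)) (isOpen_G_succ _)

theorem not_Ioo_subset_model {a b x : ℝ} (hax : a < x) (hxb : x < b) (hx : x ∈ cantorSet) :
    ¬ Ioo a b ⊆ model := by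
  intro h
  obtain ⟨n, y, hy, hyI⟩ := exists_mem_G_Ioo hax hxb hx 1
  have := h hyI
  rw [model_eq] at this
  exact this.2 (mem_iUnion.2 ⟨n, hy⟩)

theorem mem_cantorSet_of_notMem_interior_model {x : ℝ} (hx : x ∈ model) (h : x ∉ interior model) :
    x ∈ cantorSet := by
  rcases hx with hx | hx
  · exact hx
  · obtain ⟨n, hn⟩ := mem_iUnion.1 hx
    exact (h (G_odd_subset_interior_model n hn)).elim

/-- At a forbidden junction `b` lies in the Cantor set, which is perfect, so another Cantor point
lies in one of the two intervals. It belongs to the model, so it cannot be in the disjoint interval;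
removed even levels cluster at it, so it cannot be in the contained one. -/
theorem isGood_model : IsGood model where
  isCompact := by
    rw [model_eq]
    exact isCompact_Icc.diff (isOpen_iUnion fun n => isOpen_G_succ _)
  nonempty := ⟨0, Or.inl zero_mem_cantorSet⟩
  subset_closure := fun x hx => by
    by_cases h : x ∈ interior model
    · exact subset_closure h
    · have hC := mem_cantorSet_of_notMem_interior_model hx h
      refine Metric.mem_closure_iff.2 fun e he => ?_
      obtain ⟨n, y, hy, h1, h2⟩ :=
        exists_mem_G_Ioo (sub_lt_self x he) (lt_add_of_pos_right x he) hC 0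
      refine ⟨y, G_odd_subset_interior_model n hy, ?_⟩
      rw [Real.dist_eq, abs_lt]
      constructor <;> linarith
  not_left := fun a b c hab hbc hb hd hs => by
    have hC : b ∈ cantorSet := mem_cantorSet_of_notMem_interior_model hb fun hi => by
      obtain ⟨y, hy, hyi⟩ := mem_closure_iff_nhds.1
        (by rw [closure_Ioo hab.ne]; exact right_mem_Icc.2 hab.le : b ∈ closure (Ioo a b)) _
        (isOpen_interior.mem_nhds hi)
      exact disjoint_left.1 hd hyi (interior_subset hy)
    obtain ⟨y, hy, h | h⟩ := exists_mem_cantorSet_Ioo hab hbc hC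
    · exact disjoint_left.1 hd h (Or.inl hy)
    · exact not_Ioo_subset_model h.1 h.2 hy hs
  not_right := fun a b c hab hbc hb hs hd => by
    have hC : b ∈ cantorSet := mem_cantorSet_of_notMem_interior_model hb fun hi => by
      obtain ⟨y, hy, hyi⟩ := mem_closure_iff_nhds.1
        (by rw [closure_Ioo hbc.ne]; exact left_mem_Icc.2 hbc.le : b ∈ closure (Ioo b c)) _
        (isOpen_interior.mem_nhds hi)
      exact disjoint_left.1 hd hyi (interior_subset hy)
    obtain ⟨y, hy, h | h⟩ := exists_mem_cantorSet_Ioo hab hbc hC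
    · exact not_Ioo_subset_model h.1 h.2 hy hs
    · exact disjoint_left.1 hd h (Or.inl hy)

/-! ### Digits, self-similarity and compactness of `K l` -/

open scoped Pointwise

theorem zero_mem_digits (l : ℕ) : 0 ∈ digits l := ⟨0, by omega, by omega⟩

theorem le_of_mem_digits {l d : ℕ} (h : d ∈ digits l) : d ≤ 4 * l + 1 := by
  obtain ⟨j, hj, h | h⟩ := h <;> omega

theorem sub_mem_digits {l d : ℕ} (h : d ∈ digits l) : 4 * l + 1 - d ∈ digits l := by
  obtain ⟨j, hj, h | h⟩ := h
  · exact ⟨l - j, by omega, by omega⟩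
  · exact ⟨l - j, by omega, by omega⟩

/-- The digits form a complete residue system modulo the base. -/
theorem exists_digit_of_int (l : ℕ) (n : ℤ) :
    ∃ d ∈ digits l, ∃ m : ℤ, n = d + (2 * l + 2) * m := by
  have h1 := Int.emod_add_mul_ediv n (2 * l + 2)
  have h2 := Int.emod_nonneg n (by omega : (2 * l + 2 : ℤ) ≠ 0)
  have h3 := Int.emod_lt_of_pos n (by omega : (0 : ℤ) < 2 * l + 2)
  obtain ⟨r, hr⟩ := Int.eq_ofNat_of_zero_le h2
  rw [hr] at h1 h3
  rcases Nat.even_or_odd' r with ⟨j, hj | hj⟩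
  · exact ⟨r, ⟨j, by omega, Or.inl hj⟩, _, h1.symm⟩
  · by_cases hr1 : r = 2 * l + 1
    · exact ⟨r, ⟨0, by omega, by omega⟩, _, h1.symm⟩
    -- An odd residue below `2l+1` is not a digit; adding the base once gives `2l+1+2(j+1)`, which
    -- is.
    · refine ⟨2 * l + 2 + r, ⟨j + 1, by omega, by omega⟩, n / (2 * l + 2) - 1, ?_⟩
      push_cast
      linarith

theorem base_pos (l : ℕ) : (0 : ℝ) < 2 * l + 2 := by positivity

theorem hasSum_const_div_pow (l : ℕ) :
    HasSum (fun i : ℕ => (4 * (l : ℝ) + 1) / (2 * (l : ℝ) + 2) ^ (i + 1))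
      ((4 * l + 1) / (2 * l + 1)) := by
  have hB := base_pos l
  have h := (hasSum_geometric_of_lt_one (inv_nonneg.2 hB.le) (inv_lt_one_of_one_lt₀
    (by linarith [(Nat.cast_nonneg l : (0 : ℝ) ≤ l)] : (1 : ℝ) < 2 * l + 2))).mul_left
      ((4 * (l : ℝ) + 1) / (2 * l + 2))
  have h0 : (2 * (l : ℝ) + 1) ≠ 0 := by positivity
  have he : 1 - (2 * (l : ℝ) + 2)⁻¹ = (2 * l + 1) / (2 * l + 2) := by field_simp; ring
  convert! h using 1
  · ext i
    rw [pow_succ, inv_pow]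
    field_simp
  · rw [he]
    field_simp

theorem div_pow_le_of_mem_digits {l d : ℕ} (h : d ∈ digits l) (i : ℕ) :
    (d : ℝ) / (2 * (l : ℝ) + 2) ^ (i + 1) ≤ (4 * (l : ℝ) + 1) / (2 * (l : ℝ) + 2) ^ (i + 1) := by
  gcongr
  exact_mod_cast le_of_mem_digits h

theorem summable_digits {l : ℕ} {ε : ℕ → ℕ} (h : ∀ i, ε i ∈ digits l) :
    Summable fun i => (ε i : ℝ) / (2 * (l : ℝ) + 2) ^ (i + 1) :=
  Summable.of_nonneg_of_le (fun i => by positivity) (fun i => div_pow_le_of_mem_digits (h i) i)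
    (hasSum_const_div_pow l).summable

theorem zero_mem_K (l : ℕ) : (0 : ℝ) ∈ K l :=
  ⟨fun _ => 0, fun _ => zero_mem_digits l, by simp⟩

theorem nonneg_of_mem_K {l : ℕ} {x : ℝ} (h : x ∈ K l) : 0 ≤ x := by
  obtain ⟨ε, -, hs⟩ := h
  exact hs.nonneg fun i => by positivity

theorem le_of_mem_K {l : ℕ} {x : ℝ} (h : x ∈ K l) : x ≤ (4 * l + 1) / (2 * l + 1) := by
  obtain ⟨ε, hε, hs⟩ := h
  exact hasSum_le (fun i => div_pow_le_of_mem_digits (hε i) i) hs (hasSum_const_div_pow l)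

theorem max_lt_two (l : ℕ) : (4 * (l : ℝ) + 1) / (2 * l + 1) < 2 := by
  rw [div_lt_iff₀ (by positivity)]
  linarith

theorem lt_two_of_mem_K {l : ℕ} {x : ℝ} (h : x ∈ K l) : x < 2 :=
  (le_of_mem_K h).trans_lt (max_lt_two l)

theorem sub_mem_K {l : ℕ} {x : ℝ} (h : x ∈ K l) : (4 * (l : ℝ) + 1) / (2 * l + 1) - x ∈ K l := by
  obtain ⟨ε, hε, hs⟩ := h
  refine ⟨fun i => 4 * l + 1 - ε i, fun i => sub_mem_digits (hε i), ?_⟩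
  convert! (hasSum_const_div_pow l).sub hs using 2 with i
  rw [Nat.cast_sub (le_of_mem_digits (hε i))]
  push_cast
  ring

/-- Self-similarity of `K l`. -/
theorem mem_K_iff {l : ℕ} {x : ℝ} :
    x ∈ K l ↔ ∃ d ∈ digits l, ∃ y ∈ K l, x = (d + y) / (2 * l + 2) := by
  have hB := (base_pos l).ne'
  constructor
  · rintro ⟨ε, hε, hs⟩
    refine ⟨ε 0, hε 0, (2 * l + 2) * (x - ε 0 / (2 * l + 2)), ⟨fun i => ε (i + 1),
      fun i => hε _, ?_⟩, by field_simp; ring⟩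
    have := ((hasSum_nat_add_iff' 1).2 hs).mul_left (2 * (l : ℝ) + 2)
    simp only [Finset.sum_range_one, zero_add, pow_one] at this
    convert! this using 2 with i
    rw [pow_succ _ (i + 1)]
    field_simp
  · rintro ⟨d, hd, y, ⟨ε, hε, hs⟩, rfl⟩
    refine ⟨fun i => Nat.casesOn i d ε, fun i => ?_, ?_⟩
    · cases i with
      | zero => exact hd
      | succ i => exact hε i
    · rw [← hasSum_nat_add_iff' 1]
      convert! hs.mul_left (2 * (l : ℝ) + 2)⁻¹ using 1
      · ext i
        rw [pow_succ _ (i + 1)]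
        field_simp
      · simp
        field_simp
        ring

/-- A continuous image of the compact space of digit sequences, by uniform convergence of the
series. -/
theorem isCompact_K (l : ℕ) : IsCompact (K l) := by
  have hfin : (digits l).Finite := (Set.finite_Iic (4 * l + 1)).subset fun d => le_of_mem_digits
  have : Finite (digits l) := hfin.to_subtype
  have hK : K l = range fun ε : ℕ → digits l =>
      ∑' i, ((ε i : ℕ) : ℝ) / (2 * (l : ℝ) + 2) ^ (i + 1) := by
    ext x
    constructor
    · rintro ⟨ε, hε, hs⟩
      exact ⟨fun i => ⟨ε i, hε i⟩, hs.tsum_eq⟩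
    · rintro ⟨ε, rfl⟩
      exact ⟨fun i => ε i, fun i => (ε i).2, (summable_digits fun i => (ε i).2).hasSum⟩
  rw [hK]
  refine isCompact_range (continuous_tsum (fun i => ?_) (hasSum_const_div_pow l).summable
    fun i ε => ?_)
  · exact ((continuous_of_discreteTopology (f := fun d : digits l => ((d : ℕ) : ℝ))).comp
      (continuous_apply i)).div_const _
  · rw [Real.norm_of_nonneg (by positivity)]
    exact div_pow_le_of_mem_digits (ε i).2 i

/-! ### The interior of `K l` is nonempty and dense in it -/

theorem exists_mem_K_add_int (l k : ℕ) (n : ℤ) :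
    ∃ y ∈ K l, ∃ m : ℤ, (n : ℝ) / (2 * l + 2) ^ k = y + m := by
  have hB := (base_pos l).ne'
  induction k with
  | zero => exact ⟨0, zero_mem_K l, n, by simp⟩
  | succ k ih =>
    obtain ⟨y, hy, m, hm⟩ := ih
    obtain ⟨d, hd, m', rfl⟩ := exists_digit_of_int l m
    refine ⟨_, mem_K_iff.2 ⟨d, hd, y, hy, rfl⟩, m', ?_⟩
    rw [pow_succ, ← div_div, hm]
    push_cast
    field_simp
    ring

theorem tendsto_div_base_pow (l : ℕ) (c : ℝ) :
    Filter.Tendsto (fun k : ℕ => c / (2 * (l : ℝ) + 2) ^ k) Filter.atTop (nhds 0) :=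
  tendsto_const_nhds.div_atTop (tendsto_pow_atTop_atTop_of_one_lt
    (by linarith [(Nat.cast_nonneg l : (0 : ℝ) ≤ l)]))

theorem exists_div_base_pow_lt (l : ℕ) (c : ℝ) {e : ℝ} (he : 0 < e) :
    ∃ k : ℕ, 0 < k ∧ c / (2 * (l : ℝ) + 2) ^ k < e :=
  (((Filter.eventually_gt_atTop 0).and
    ((tendsto_div_base_pow l c).eventually (gt_mem_nhds he))).exists)

/-- The integer translates of `K l` cover the line. -/
theorem exists_int_sub_mem_K (l : ℕ) (x : ℝ) : ∃ m : ℤ, x - m ∈ K l := by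
  have hcl : IsClosed (K l + range ((↑) : ℤ → ℝ)) :=
    IsClosed.add_left_of_isCompact Int.isClosedEmbedding_coe_real.isClosed_range (isCompact_K l)
  -- Rounding `x` down to a multiple of `(2l+2)^(-k)` lands in the sumset with error below
  -- `(2l+2)^(-k)`.
  have hx : x ∈ closure (K l + range ((↑) : ℤ → ℝ)) := by
    refine Metric.mem_closure_iff.2 fun e he => ?_
    obtain ⟨k, -, hk⟩ := exists_div_base_pow_lt l 1 he
    have hpos : (0 : ℝ) < (2 * l + 2) ^ k := pow_pos (base_pos l) k
    obtain ⟨y, hy, m, hm⟩ := exists_mem_K_add_int l k ⌊x * (2 * l + 2) ^ k⌋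
    refine ⟨_, add_mem_add hy (mem_range_self m), ?_⟩
    rw [← hm, Real.dist_eq]
    refine lt_of_le_of_lt ?_ hk
    have h1 := Int.floor_le (x * (2 * (l : ℝ) + 2) ^ k)
    have h2 := Int.lt_floor_add_one (x * (2 * (l : ℝ) + 2) ^ k)
    have he : x - (⌊x * (2 * (l : ℝ) + 2) ^ k⌋ : ℝ) / (2 * l + 2) ^ k =
        (x * (2 * l + 2) ^ k - ⌊x * (2 * (l : ℝ) + 2) ^ k⌋) / (2 * l + 2) ^ k := by
      field_simp
    rw [he, abs_of_nonneg (div_nonneg (by linarith) hpos.le)]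
    gcongr
    linarith
  rw [hcl.closure_eq] at hx
  obtain ⟨y, hy, _, ⟨m, rfl⟩, h⟩ := hx
  exact ⟨m, by rw [← h]; simpa using hy⟩

/-- Baire: countably many closed translates cover the line. -/
theorem nonempty_interior_K (l : ℕ) : (interior (K l)).Nonempty := by
  obtain ⟨m, x, hx⟩ := nonempty_interior_of_iUnion_of_closed
    (f := fun m : ℤ => (fun x : ℝ => x - m) ⁻¹' K l)
    (fun m => (isCompact_K l).isClosed.preimage (by fun_prop))
    (by ext x; simpa using exists_int_sub_mem_K l x)
  have := (Homeomorph.subRight (m : ℝ)).preimage_interior (K l)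
  change (fun x : ℝ => x - m) ⁻¹' interior (K l) = interior ((fun x : ℝ => x - m) ⁻¹' K l) at this
  rw [← this] at hx
  exact ⟨_, hx⟩

/-- The integers with an expansion of length `k` with digits in `digits l`. -/
def words (l : ℕ) : ℕ → Set ℕ
  | 0 => {0}
  | k + 1 => {N | ∃ N' ∈ words l k, ∃ d ∈ digits l, N = N' * (2 * l + 2) + d}

theorem mem_K_iff_words {l : ℕ} (k : ℕ) {x : ℝ} :
    x ∈ K l ↔ ∃ N ∈ words l k, ∃ y ∈ K l, x = (N + y) / (2 * l + 2) ^ k := by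
  have hB := (base_pos l).ne'
  induction k with
  | zero => simp [words]
  | succ k ih =>
    refine ih.trans ⟨?_, ?_⟩
    · rintro ⟨N, hN, y, hy, rfl⟩
      obtain ⟨d, hd, w, hw, rfl⟩ := mem_K_iff.1 hy
      refine ⟨_, ⟨N, hN, d, hd, rfl⟩, w, hw, ?_⟩
      push_cast
      rw [pow_succ]
      field_simp
      ring
    · rintro ⟨_, ⟨N, hN, d, hd, rfl⟩, y, hy, rfl⟩
      refine ⟨N, hN, _, mem_K_iff.2 ⟨d, hd, y, hy, rfl⟩, ?_⟩
      push_cast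
      rw [pow_succ]
      field_simp
      ring

theorem K_subset_closure_interior (l : ℕ) : K l ⊆ closure (interior (K l)) := by
  intro x hx
  obtain ⟨z, hz⟩ := nonempty_interior_K l
  refine Metric.mem_closure_iff.2 fun e he => ?_
  obtain ⟨k, -, hk⟩ := exists_div_base_pow_lt l 2 he
  have hpos : (0 : ℝ) < (2 * l + 2) ^ k := pow_pos (base_pos l) k
  obtain ⟨N, hN, y, hy, rfl⟩ := (mem_K_iff_words k).1 hx
  -- The cylinder of `N` is a scaled copy of `K l`, so it carries a scaled copy of the interior
  -- point `z`; since `K l ⊆ [0, 2)`, this lies within `2 / (2l+2)^k` of `x`.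
  have hsub : (fun t : ℝ => t * (2 * l + 2) ^ k - N) ⁻¹' interior (K l) ⊆ K l := fun t ht =>
    (mem_K_iff_words k).2 ⟨N, hN, _, interior_subset ht, by field_simp; ring⟩
  refine ⟨(N + z) / (2 * l + 2) ^ k, interior_maximal hsub
    (isOpen_interior.preimage (by fun_prop)) ?_, ?_⟩
  · have : (N + z) / (2 * (l : ℝ) + 2) ^ k * (2 * l + 2) ^ k - N = z := by field_simp; ring
    simpa only [mem_preimage, this] using hz
  · have hz' := interior_subset hz
    rw [Real.dist_eq, ← sub_div, abs_div, abs_of_pos hpos]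
    refine lt_of_le_of_lt ?_ hk
    gcongr
    rw [abs_le]
    constructor <;> linarith [nonneg_of_mem_K hy, nonneg_of_mem_K hz', lt_two_of_mem_K hy,
      lt_two_of_mem_K hz']

/-! ### Holes of `K l` and goodness -/

/-- Scaling up by the base yields `d + y < 2`, which forces the first digit to be `0`; descending
reaches `t` itself, beyond the maximum of `K l`. These holes accumulate at `0`. -/
theorem div_base_pow_notMem_K {l : ℕ} (hl : 1 ≤ l) {t : ℝ} (ht : (4 * (l : ℝ) + 1) / (2 * l + 1) < t)
    (ht2 : t < 2) (m : ℕ) : t / (2 * l + 2) ^ m ∉ K l := by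
  have hB := base_pos l
  have ht0 : 0 < t := lt_of_le_of_lt (by positivity) ht
  induction m with
  | zero => exact fun h => ht.not_ge (by simpa using le_of_mem_K h)
  | succ m ih =>
    intro h
    obtain ⟨d, hd, y, hy, he⟩ := mem_K_iff.1 h
    have he' : t / (2 * (l : ℝ) + 2) ^ m = d + y := by
      rw [pow_succ, ← div_div] at he
      field_simp at he ⊢
      linarith
    have hlt : t / (2 * (l : ℝ) + 2) ^ m < 2 :=
      (div_le_self ht0.le (one_le_pow₀ (by linarith [(Nat.cast_nonneg l : (0 : ℝ) ≤ l)]))).trans_lt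
        ht2
    have hd2 : d < 2 := by
      have : (d : ℝ) < 2 := by linarith [nonneg_of_mem_K hy]
      exact_mod_cast this
    have hd0 : d = 0 := by obtain ⟨j, hj, h | h⟩ := hd <;> omega
    rw [hd0, Nat.cast_zero, zero_add] at he'
    exact ih (he' ▸ hy)

theorem not_Ioo_subset_K_of_disjoint {l : ℕ} (hl : 1 ≤ l) {a b c : ℝ} (hab : a < b) (hbc : b < c)
    (hb : b ∈ K l) (hd : Disjoint (Ioo a b) (K l)) : ¬ Ioo b c ⊆ K l := by
  obtain ⟨k, -, hk⟩ := exists_div_base_pow_lt l 2 (sub_pos.2 hab)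
  have hpos : (0 : ℝ) < (2 * l + 2) ^ k := pow_pos (base_pos l) k
  obtain ⟨N, hN, y, hy, rfl⟩ := (mem_K_iff_words k).1 hb
  -- By the choice of `k`, a corner less than `b` and within `2 / (2l+2)^k` of it would lie in the
  -- empty interval `(a, b)`.
  have hcorner : ∀ N' ∈ words l k, (N' : ℝ) < N + y → (N : ℝ) + y - N' ≤ 2 → False := by
    intro N' hN' h1 h2
    refine disjoint_left.1 hd ⟨?_, ?_⟩
      ((mem_K_iff_words k).2 ⟨N', hN', 0, zero_mem_K l, rfl⟩)
    · have : (N + y) / (2 * (l : ℝ) + 2) ^ k - (N' + 0) / (2 * l + 2) ^ k ≤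
          2 / (2 * l + 2) ^ k := by
        rw [← sub_div]
        gcongr
        linarith
      linarith
    · rw [add_zero]
      exact div_lt_div_of_pos_right h1 hpos
  have hy0 : y = 0 := by
    by_contra hne
    have : 0 < y := lt_of_le_of_ne (nonneg_of_mem_K hy) (Ne.symm hne)
    exact hcorner N hN (by linarith) (by linarith [lt_two_of_mem_K hy])
  subst hy0
  intro hsub
  obtain ⟨m, hm0, hm⟩ := exists_div_base_pow_lt l 2
    (mul_pos (sub_pos.2 hbc) hpos)
  obtain ⟨t, ht1, ht2⟩ := exists_between (max_lt_two l)
  have ht0 : 0 < t := lt_of_le_of_lt (by positivity) ht1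
  have hposm : (0 : ℝ) < (2 * l + 2) ^ m := pow_pos (base_pos l) m
  have hs0 : 0 < t / (2 * (l : ℝ) + 2) ^ m := div_pos ht0 hposm
  have hs1 : t / (2 * (l : ℝ) + 2) ^ m < 1 := by
    rw [div_lt_one hposm]
    have h1 : (2 * (l : ℝ) + 2) ≤ (2 * l + 2) ^ m :=
      le_self_pow₀ (by linarith [(Nat.cast_nonneg l : (0 : ℝ) ≤ l)]) hm0.ne'
    linarith [(Nat.cast_nonneg l : (0 : ℝ) ≤ l)]
  have hs2 : t / (2 * (l : ℝ) + 2) ^ m < 2 / (2 * l + 2) ^ m := by gcongr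
  have hmem : (N + t / (2 * (l : ℝ) + 2) ^ m) / (2 * l + 2) ^ k ∈ K l := by
    refine hsub ⟨by gcongr, ?_⟩
    rw [div_lt_iff₀ hpos]
    have : (N + 0) / (2 * (l : ℝ) + 2) ^ k * (2 * l + 2) ^ k = N := by field_simp; ring
    nlinarith
  obtain ⟨N', hN', w, hw, he⟩ := (mem_K_iff_words k).1 hmem
  have he' : (N : ℝ) + t / (2 * (l : ℝ) + 2) ^ m = N' + w := by
    rwa [div_left_inj' hpos.ne'] at he
  have hw0 := nonneg_of_mem_K hw
  have hw2 := lt_two_of_mem_K hw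
  -- A smaller `N'` is an excluded corner, since `w < 2`; equality contradicts the hole at `t /
  -- (2l+2)^m`; a larger `N'` overshoots, since that offset is below `1`.
  rcases lt_trichotomy N' N with h | h | h
  · exact hcorner N' hN' (by simpa using h) (by linarith)
  · rw [h] at he'
    exact div_base_pow_notMem_K hl ht1 ht2 m ((add_left_cancel he') ▸ hw)
  · have : (N : ℝ) + 1 ≤ N' := by exact_mod_cast h
    linarith

theorem isGood_K {l : ℕ} (hl : 1 ≤ l) : IsGood (K l) where
  isCompact := isCompact_K l
  nonempty := ⟨0, zero_mem_K l⟩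
  subset_closure := K_subset_closure_interior l
  not_left := fun a b c hab hbc hb hd => not_Ioo_subset_K_of_disjoint hl hab hbc hb hd
  not_right := fun a b c hab hbc hb hs hd => by
    set M : ℝ := (4 * (l : ℝ) + 1) / (2 * l + 1) with hM
    -- The reflection `x ↦ M - x` preserves `K l` and exchanges the two sides.
    refine not_Ioo_subset_K_of_disjoint hl (sub_lt_sub_left hbc M) (sub_lt_sub_left hab M)
      (sub_mem_K hb) (disjoint_left.2 fun x hx hxK => ?_) fun x hx => ?_
    · exact disjoint_left.1 hd ⟨by linarith [hx.2], by linarith [hx.1]⟩ (sub_mem_K hxK)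
    · have := sub_mem_K (hs (⟨by linarith [hx.2], by linarith [hx.1]⟩ : M - x ∈ Ioo a b))
      rwa [← hM, sub_sub_cancel] at this

theorem perfect_K {l : ℕ} : Perfect (K l) := by
  refine ⟨(isCompact_K l).isClosed, fun x hx => ?_⟩
  rw [accPt_iff_nhds]
  intro U hU
  have hx' := K_subset_closure_interior l hx
  obtain ⟨y, hyU, hy⟩ := mem_closure_iff_nhds.1 hx' _ (interior_mem_nhds.2 hU)
  have hopen : IsOpen (interior U ∩ interior (K l)) := isOpen_interior.inter isOpen_interior
  have hinf : (interior U ∩ interior (K l)).Infinite :=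
    infinite_of_mem_nhds y (hopen.mem_nhds ⟨hyU, hy⟩)
  obtain ⟨w, hw, hwx⟩ := hinf.exists_notMem_finite (Set.finite_singleton x)
  exact ⟨w, ⟨interior_subset hw.1, interior_subset hw.2⟩, hwx⟩

/-! ### `K l` as a set of subsums -/

theorem z_mul_add (l i : ℕ) (r : Fin (l + 1)) :
    z l (i * (l + 1) + r) =
      ((if r = 0 then 2 * l + 1 else 2 : ℕ) : ℝ) / (2 * (l : ℝ) + 2) ^ (i + 1) := by
  have h1 : (i * (l + 1) + r) % (l + 1) = r := by
    rw [Nat.mul_add_mod_self_right, Nat.mod_eq_of_lt r.2]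
  have h2 : (i * (l + 1) + r) / (l + 1) = i := by
    rw [add_comm, Nat.add_mul_div_right _ _ (Nat.succ_pos l), Nat.div_eq_of_lt r.2, zero_add]
  rw [z, h1, h2]
  by_cases h : r = 0
  · simp [h]
  · simp [h, Fin.val_eq_zero_iff]

theorem z_nonneg (l n : ℕ) : 0 ≤ z l n := by
  unfold z
  split_ifs <;> positivity

theorem summable_z (l : ℕ) : Summable (z l) := by
  rw [← (Nat.divModEquiv (l + 1)).symm.summable_iff]
  have h1 : Summable fun i : ℕ => 1 / (2 * (l : ℝ) + 2) ^ (i + 1) := by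
    convert! (hasSum_const_div_pow l).summable.mul_left (4 * (l : ℝ) + 1)⁻¹ using 2 with i
    field_simp
  have h2 : Summable fun r : Fin (l + 1) => ((if r = 0 then 2 * l + 1 else 2 : ℕ) : ℝ) :=
    (hasSum_fintype _).summable
  convert! h1.mul_of_nonneg h2 (fun i => by positivity) (fun r => by positivity) using 2 with p
  simp only [Function.comp, Nat.divModEquiv_symm_apply, z_mul_add]
  ring

/-- The first term contributes `0` or `2l+1`; the `l` others contribute twice the number chosen,
which serves as `j`. -/
theorem sum_block_mem_digits {l : ℕ} {η : Fin (l + 1) → ℕ} (hη : ∀ r, η r = 0 ∨ η r = 1) :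
    ∑ r, η r * (if r = 0 then 2 * l + 1 else 2) ∈ digits l := by
  have hle : ∑ r : Fin l, η r.succ ≤ l := by
    calc ∑ r : Fin l, η r.succ ≤ ∑ r : Fin l, 1 :=
          Finset.sum_le_sum fun r _ => by rcases hη r.succ with h | h <;> omega
      _ = l := by simp
  refine ⟨_, hle, ?_⟩
  rw [Fin.sum_univ_succ]
  simp only [if_true, Fin.succ_ne_zero, if_false, ← Finset.sum_mul]
  rcases hη 0 with h | h
  · left; rw [h]; ring
  · right; rw [h]; ring

theorem exists_block_of_mem_digits {l d : ℕ} (hd : d ∈ digits l) :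
    ∃ η : Fin (l + 1) → ℕ, (∀ r, η r = 0 ∨ η r = 1) ∧
      ∑ r, η r * (if r = 0 then 2 * l + 1 else 2) = d := by
  obtain ⟨j, hj, hd⟩ := hd
  have hsum : ∑ r : Fin l, (if (r : ℕ) < j then 1 else 0) = j := by
    rw [Fin.sum_univ_eq_sum_range (fun r => if r < j then 1 else 0), Finset.sum_boole]
    have : (Finset.range l).filter (fun r => r < j) = Finset.range j := by
      ext r
      simp only [Finset.mem_filter, Finset.mem_range]
      omega
    simp [this]
  have key : ∀ e : ℕ, (e = 0 ∨ e = 1) → ∃ η : Fin (l + 1) → ℕ, (∀ r, η r = 0 ∨ η r = 1) ∧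
      ∑ r, η r * (if r = 0 then 2 * l + 1 else 2) = e * (2 * l + 1) + j * 2 := by
    intro e he
    refine ⟨Fin.cons e fun r => if (r : ℕ) < j then 1 else 0, fun r => ?_, ?_⟩
    · refine Fin.cases ?_ (fun r => ?_) r
      · simpa using he
      · simp only [Fin.cons_succ]
        split_ifs <;> simp
    · rw [Fin.sum_univ_succ]
      simp only [if_true, Fin.succ_ne_zero, if_false, ← Finset.sum_mul, Fin.cons_zero,
        Fin.cons_succ, hsum]
  rcases hd with rfl | rfl
  · obtain ⟨η, h1, h2⟩ := key 0 (by simp)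
    exact ⟨η, h1, by rw [h2]; ring⟩
  · obtain ⟨η, h1, h2⟩ := key 1 (by simp)
    exact ⟨η, h1, by rw [h2]; ring⟩

/-- Regroups the series along `n = i(l+1) + r`, each fibre being finite. -/
theorem hasSum_blocks {l : ℕ} {δ : ℕ → ℕ} {x : ℝ} (h : HasSum (fun n => (δ n : ℝ) * z l n) x) :
    HasSum (fun i : ℕ => ((∑ r : Fin (l + 1), δ (i * (l + 1) + r) *
      (if r = 0 then 2 * l + 1 else 2) : ℕ) : ℝ) / (2 * (l : ℝ) + 2) ^ (i + 1)) x := by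
  have h' := ((Nat.divModEquiv (l + 1)).symm.hasSum_iff.2 h).prod_fiberwise
    fun i => hasSum_fintype _
  convert! h' using 2 with i
  rw [Nat.cast_sum, Finset.sum_div]
  refine Finset.sum_congr rfl fun r _ => ?_
  simp only [Function.comp, Nat.divModEquiv_symm_apply, z_mul_add, Nat.cast_mul]
  ring

theorem K_eq_subsums (l : ℕ) : K l = subsums (z l) := by
  ext x
  constructor
  · rintro ⟨ε, hε, hs⟩
    choose η hη hsum using fun i => exists_block_of_mem_digits (hε i)
    let δ : ℕ → ℕ := fun n => η (Nat.divModEquiv (l + 1) n).1 (Nat.divModEquiv (l + 1) n).2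
    have hδ : ∀ n, δ n = 0 ∨ δ n = 1 := fun n => hη _ _
    have hδη : ∀ i (r : Fin (l + 1)), δ (i * (l + 1) + r) = η i r := fun i r => by
      have := (Nat.divModEquiv (l + 1)).apply_symm_apply (i, r)
      rw [Nat.divModEquiv_symm_apply] at this
      simp only [δ]
      rw [this]
    have hsm : Summable fun n => (δ n : ℝ) * z l n := by
      refine Summable.of_nonneg_of_le (fun n => mul_nonneg (Nat.cast_nonneg _) (z_nonneg l n))
        (fun n => ?_) (summable_z l)
      rcases hδ n with h | h
      · simp [h, z_nonneg]
      · simp [h]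
    refine ⟨δ, hδ, ?_⟩
    have h2 := hasSum_blocks hsm.hasSum
    simp only [hδη, hsum] at h2
    rw [hs.unique h2]
    exact hsm.hasSum
  · rintro ⟨δ, hδ, hs⟩
    exact ⟨_, fun i => sum_block_mem_digits fun r => hδ _, hasSum_blocks hs⟩

end Cantorval

theorem mainTheorem2 (l : ℕ) (hl : 1 ≤ l) :
    (Summable (Cantorval.z l) ∧ Cantorval.K l = Cantorval.subsums (Cantorval.z l)) ∧
      Cantorval.IsMCantorval (Cantorval.K l) ∧
      Perfect (Cantorval.K l) ∧
      (interior (Cantorval.K l)).Nonempty :=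
  ⟨⟨Cantorval.summable_z l, Cantorval.K_eq_subsums l⟩,
    (Cantorval.isGood_K hl).nonempty_homeomorph Cantorval.isGood_model,
    Cantorval.perfect_K, Cantorval.nonempty_interior_K l⟩
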